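/- Let $X$ be a real Banach space with continuous dual $X^*$ and bidual $X^{**}$, where $X$ is identified with its canonical image in $X^{**}$ and $\langle\cdot,\cdot\rangle$ denotes the duality pairings. Let $A:X\rightrightarrows X^*$ be a set-valued operator with graph $\operatorname{gra}A=\{(x,x^*)\in X\times X^*: x^*\in Ax\}$ and range $\operatorname{ran}A=\bigcup_{x\in X}Ax$. Suppose that $A$ is maximally monotone, i.e. $\langle x-y,x^*-y^*\rangle\ge 0$ for all $(x,x^*),(y,y^*)\in\operatorname{gra}A$, and no monotone operator has a graph properly containing $\operatorname{gra}A$. Then the following are equivalent. (i) $A$ is of type (D) (dense type): for every $(x^{**},x^*)\in X^{**}\times X^*$ with $\inf_{(a,a^*)\in\operatorname{gra}A}\langle a-x^{**},a^*-x^*\rangle\ge 0$ there is a bounded net $(a_\alpha,a^*_\alpha)_{\alpha\in\Gamma}$ in $\operatorname{gra}A$ such that $a_\alpha\to x^{**}$ in the weak$^*$ topology $\omega(X^{**},X^*)$ and $a^*_\alpha\to x^*$ in norm. (ii) $A$ is of type (NI) (negative infimum): $\inf_{(a,a^*)\in\operatorname{gra}A}\langle a-x^{**},a^*-x^*\rangle\le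 0$ for all $(x^{**},x^*)\in X^{**}\times X^*$. (iii) $A$ is of type (FP) (Fitzpatrick–Phelps): whenever $U\subseteq X^*$ is open and convex with $U\cap\operatorname{ran}A\ne\varnothing$, $x\in X$, $x^*\in U$, and $\langle x-y,x^*-y^*\rangle\ge 0$ for all $(y,y^*)\in\operatorname{gra}A$ with $y^*\in U$, it follows that $(x,x^*)\in\operatorname{gra}A$. -/

import Mathlib

open Filter Topology

universe u

namespace BanachOperator

variable {X : Type u} [NormedAddCommGroup X] [NormedSpace ℝ X]

/-- The graph of a set-valued operator `A : X ⇉ X*`. -/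
def graph (A : X → Set (StrongDual ℝ X)) : Set (X × StrongDual ℝ X) :=
  {p | p.2 ∈ A p.1}

/-- The range of a set-valued operator `A : X ⇉ X*`. -/
def range (A : X → Set (StrongDual ℝ X)) : Set (StrongDual ℝ X) :=
  ⋃ x, A x

/-- `A` is monotone: `⟨x - y, x* - y*⟩ ≥ 0` for all `(x, x*)`, `(y, y*)` in the graph. -/
def IsMonotone (A : X → Set (StrongDual ℝ X)) : Prop :=
  ∀ p ∈ graph A, ∀ q ∈ graph A, 0 ≤ (p.2 - q.2) (p.1 - q.1)

/-- `A` is maximally monotone: it is monotone and has no proper monotone extension. -/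
def IsMaximallyMonotone (A : X → Set (StrongDual ℝ X)) : Prop :=
  IsMonotone A ∧
    ∀ B : X → Set (StrongDual ℝ X), IsMonotone B → graph A ⊆ graph B → graph B = graph A

/-- The point `p = (x, x*)` is monotonically related to the set `S ⊆ X × X*`. -/
def IsMonotonicallyRelated (p : X × StrongDual ℝ X) (S : Set (X × StrongDual ℝ X)) : Prop :=
  ∀ q ∈ S, 0 ≤ (p.2 - q.2) (p.1 - q.1)

/-- The infimum of `⟨a - x**, a* - x*⟩` over all `(a, a*)` in the graph of `A`, as an extended
real number; `a` is regarded as an element of `X**` through the canonical embedding. -/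
noncomputable def graphInf (A : X → Set (StrongDual ℝ X))
    (xss : StrongDual ℝ (StrongDual ℝ X)) (xs : StrongDual ℝ X) : EReal :=
  ⨅ p ∈ graph A, (((NormedSpace.inclusionInDoubleDual ℝ X p.1 - xss) (p.2 - xs) : ℝ) : EReal)

/-- `A` is of dense type, or type (D): every `(x**, x*)` with
`inf_{(a, a*) ∈ gra A} ⟨a - x**, a* - x*⟩ ≥ 0` is the weak* × norm limit of a bounded net in the
graph of `A`. (Index sets in the universe of `X` suffice, since neighbourhoods of `(x**, x*)`
can serve as indices.) -/
def IsTypeD (A : X → Set (StrongDual ℝ X)) : Prop :=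
  ∀ (xss : StrongDual ℝ (StrongDual ℝ X)) (xs : StrongDual ℝ X), 0 ≤ graphInf A xss xs →
    ∃ (Γ : Type u) (_ : Preorder Γ) (_ : IsDirectedOrder Γ) (_ : Nonempty Γ)
      (a : Γ → X) (as : Γ → StrongDual ℝ X),
      (∀ γ, (a γ, as γ) ∈ graph A) ∧
      (∃ M : ℝ, ∀ γ, ‖a γ‖ ≤ M ∧ ‖as γ‖ ≤ M) ∧
      Tendsto (fun γ => StrongDual.toWeakDual (NormedSpace.inclusionInDoubleDual ℝ X (a γ)))
        atTop (𝓝 (StrongDual.toWeakDual xss)) ∧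
      Tendsto as atTop (𝓝 xs)

/-- `A` is of negative infimum type, or type (NI). -/
def IsTypeNI (A : X → Set (StrongDual ℝ X)) : Prop :=
  ∀ (xss : StrongDual ℝ (StrongDual ℝ X)) (xs : StrongDual ℝ X), graphInf A xss xs ≤ 0

/-- `A` is of Fitzpatrick–Phelps type, or type (FP). -/
def IsTypeFP (A : X → Set (StrongDual ℝ X)) : Prop :=
  ∀ U : Set (StrongDual ℝ X), IsOpen U → Convex ℝ U → (U ∩ range A).Nonempty →
    ∀ (x : X) (xs : StrongDual ℝ X), xs ∈ U →
      IsMonotonicallyRelated (x, xs) (graph A ∩ (Set.univ ×ˢ U)) → (x, xs) ∈ graph A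

end BanachOperator

namespace BanachOperator

variable {X : Type u} [NormedAddCommGroup X] [NormedSpace ℝ X]

/-- A set of pairs is of negative infimum type. -/
def NegInf (S : Set (X × StrongDual ℝ X)) : Prop :=
  ∀ (xss : StrongDual ℝ (StrongDual ℝ X)) (xs : StrongDual ℝ X) (ε : ℝ), 0 < ε →
    ∃ q ∈ S, (q.2 - xs) q.1 - xss (q.2 - xs) < ε

/-- A set of pairs is monotone. -/
def MonotoneSet (S : Set (X × StrongDual ℝ X)) : Prop :=
  ∀ p ∈ S, ∀ q ∈ S, 0 ≤ (p.2 - q.2) (p.1 - q.1)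

/-- The convex hull of the graph of the duality pairing over `S`; its lower envelope is the
largest convex function lying below the pairing on `S`. -/
def pairingHull (S : Set (X × StrongDual ℝ X)) : Set (X × StrongDual ℝ X × ℝ) :=
  convexHull ℝ ((fun q : X × StrongDual ℝ X => (q.1, q.2, q.2 q.1)) '' S)

theorem subset_pairingHull {S : Set (X × StrongDual ℝ X)} {q : X × StrongDual ℝ X}
    (hq : q ∈ S) : (q.1, q.2, q.2 q.1) ∈ pairingHull S :=
  subset_convexHull ℝ _ ⟨q, hq, rfl⟩

/-- An affine inequality valid on the generators of the pairing hull is valid on the hull. -/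
theorem le_of_mem_pairingHull {S : Set (X × StrongDual ℝ X)}
    (ys : StrongDual ℝ X) (yss : StrongDual ℝ (StrongDual ℝ X)) (t c : ℝ)
    (h : ∀ q ∈ S, c ≤ ys q.1 + yss q.2 + t * q.2 q.1)
    {k : X × StrongDual ℝ X × ℝ} (hk : k ∈ pairingHull S) :
    c ≤ ys k.1 + yss k.2.1 + t * k.2.2 := by
  have hconv : Convex ℝ {k : X × StrongDual ℝ X × ℝ | c ≤ ys k.1 + yss k.2.1 + t * k.2.2} := by
    intro p hp q hq a b ha hb hab
    simp only [Set.mem_ofPred_eq, Prod.fst_add, Prod.snd_add, Prod.smul_fst, Prod.smul_snd,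
      map_add, map_smul, smul_eq_mul] at hp hq ⊢
    have hb' : b = 1 - a := by linarith
    subst hb'
    nlinarith [mul_le_mul_of_nonneg_left hp ha, mul_le_mul_of_nonneg_left hq hb]
  refine convexHull_min ?_ hconv hk
  rintro _ ⟨q, hq, rfl⟩
  exact h q hq

/-- The Fitzpatrick inequality on the pairing hull. -/
theorem fitzpatrick_le_of_mem_pairingHull {S : Set (X × StrongDual ℝ X)}
    (b : X × StrongDual ℝ X) (hb : ∀ q ∈ S, 0 ≤ (q.2 - b.2) (q.1 - b.1))
    {k : X × StrongDual ℝ X × ℝ} (hk : k ∈ pairingHull S) :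
    b.2 k.1 + k.2.1 b.1 - b.2 b.1 ≤ k.2.2 := by
  have := le_of_mem_pairingHull (-b.2) (-(NormedSpace.inclusionInDoubleDual ℝ X b.1)) 1
    (-b.2 b.1) (fun q hq => by
      have := hb q hq
      simp only [sub_apply, map_sub, neg_apply,
        NormedSpace.dual_def] at this ⊢
      linarith) hk
  simp only [neg_apply, NormedSpace.dual_def] at this
  linarith

/-- Monotonicity on the pairing hull. -/
theorem MonotoneSet.pairing_le {S : Set (X × StrongDual ℝ X)} (hS : MonotoneSet S)
    {k l : X × StrongDual ℝ X × ℝ} (hk : k ∈ pairingHull S) (hl : l ∈ pairingHull S) :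
    l.2.1 k.1 + k.2.1 l.1 ≤ k.2.2 + l.2.2 := by
  have := le_of_mem_pairingHull (-l.2.1) (-(NormedSpace.inclusionInDoubleDual ℝ X l.1)) 1
    (-l.2.2) (fun q hq => by
      have := fitzpatrick_le_of_mem_pairingHull q (fun p hp => hS p hp q hq) hl
      simp only [neg_apply, NormedSpace.dual_def]
      linarith) hk
  simp only [neg_apply, NormedSpace.dual_def] at this
  linarith

theorem MonotoneSet.apply_le {S : Set (X × StrongDual ℝ X)} (hS : MonotoneSet S)
    {k : X × StrongDual ℝ X × ℝ} (hk : k ∈ pairingHull S) : k.2.1 k.1 ≤ k.2.2 := by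
  have := hS.pairing_le hk hk
  linarith

/-- The conjugate of the pairing over a set of negative infimum type lies above the pairing. -/
theorem NegInf.mul_le {S : Set (X × StrongDual ℝ X)} (hS : NegInf S)
    {ys : StrongDual ℝ X} {yss : StrongDual ℝ (StrongDual ℝ X)} {t c : ℝ} (ht : 0 < t)
    (h : ∀ q ∈ S, c ≤ ys q.1 + yss q.2 + t * q.2 q.1) : c * t ≤ -yss ys := by
  refine le_of_forall_pos_lt_add fun ε hε => ?_
  obtain ⟨q, hq, hlt⟩ := hS (-(t⁻¹ • yss)) (-(t⁻¹ • ys)) (ε / t ^ 2) (by positivity)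
  have hc := h q hq
  simp only [sub_neg_eq_add, map_add, map_smul, add_apply,
    smul_apply, neg_apply, smul_eq_mul] at hlt
  rw [lt_div_iff₀ (by positivity)] at hlt
  have : (q.2 q.1 + t⁻¹ * ys q.1 - -(t⁻¹ * yss q.2 + t⁻¹ * (t⁻¹ * yss ys))) * t ^ 2
      = t * (ys q.1 + yss q.2 + t * q.2 q.1) + yss ys := by
    field_simp
    ring
  have h2 := mul_le_mul_of_nonneg_left hc ht.le
  linarith

/-- The translate of a set of pairs. -/
def translate (S : Set (X × StrongDual ℝ X)) (w : X × StrongDual ℝ X) :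
    Set (X × StrongDual ℝ X) :=
  (fun q => q - w) '' S

theorem NegInf.translate {S : Set (X × StrongDual ℝ X)} (hS : NegInf S)
    (w : X × StrongDual ℝ X) : NegInf (translate S w) := by
  intro xss xs ε hε
  obtain ⟨q, hq, hlt⟩ := hS (xss + NormedSpace.inclusionInDoubleDual ℝ X w.1) (xs + w.2) ε hε
  refine ⟨q - w, ⟨q, hq, rfl⟩, ?_⟩
  simp only [Prod.fst_sub, Prod.snd_sub, map_sub, map_add, add_apply,
    sub_apply, NormedSpace.dual_def] at hlt ⊢
  linarith

theorem mem_pairingHull_of_translate {S : Set (X × StrongDual ℝ X)} (w : X × StrongDual ℝ X)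
    {k : X × StrongDual ℝ X × ℝ} (hk : k ∈ pairingHull (translate S w)) :
    (k.1 + w.1, k.2.1 + w.2, k.2.2 + w.2 k.1 + k.2.1 w.1 + w.2 w.1) ∈ pairingHull S := by
  have hconv : Convex ℝ {k : X × StrongDual ℝ X × ℝ |
      (k.1 + w.1, k.2.1 + w.2, k.2.2 + w.2 k.1 + k.2.1 w.1 + w.2 w.1) ∈ pairingHull S} := by
    intro p hp q hq a b ha hb hab
    have h := (convex_convexHull ℝ _ : Convex ℝ (pairingHull S)) hp hq ha hb hab
    simp only [Set.mem_ofPred_eq]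
    refine Eq.mp (congrArg (· ∈ pairingHull S) ?_) h
    have hb' : b = 1 - a := by linarith
    subst hb'
    refine Prod.ext ?_ (Prod.ext ?_ ?_)
    · simp only [Prod.fst_add, Prod.smul_fst]; module
    · simp only [Prod.fst_add, Prod.smul_fst, Prod.snd_add, Prod.smul_snd]; module
    · simp; ring
  refine convexHull_min ?_ hconv hk
  rintro _ ⟨_, ⟨q, hq, rfl⟩, rfl⟩
  simp only [Set.mem_ofPred_eq]
  convert subset_pairingHull hq using 1
  ext <;> simp

theorem exists_dual_prod {E F : Type*} [NormedAddCommGroup E] [NormedSpace ℝ E]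
    [NormedAddCommGroup F] [NormedSpace ℝ F] (f : StrongDual ℝ (E × F)) :
    ∃ (g : StrongDual ℝ E) (h : StrongDual ℝ F), ∀ x y, f (x, y) = g x + h y := by
  refine ⟨f.comp (ContinuousLinearMap.inl ℝ E F), f.comp (ContinuousLinearMap.inr ℝ E F),
    fun x y => ?_⟩
  simp [← map_add]

theorem dual_real_apply (f : StrongDual ℝ ℝ) (r : ℝ) : f r = f 1 * r := by
  have := f.map_smul r 1
  simp only [smul_eq_mul, mul_one] at this
  linarith

/-- The conjugate of `‖x‖² / (2 N)` is `N / 2 * ‖y‖²`. -/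
theorem half_mul_sq_norm_le {y : StrongDual ℝ X} {N C : ℝ} (hN : 0 < N)
    (h : ∀ x, y x - ‖x‖ ^ 2 / (2 * N) ≤ C) : N / 2 * ‖y‖ ^ 2 ≤ C := by
  have hC : 0 ≤ C := by simpa using h 0
  have hy : ‖y‖ ≤ √(2 * C / N) := by
    refine y.opNorm_le_bound (Real.sqrt_nonneg _) fun x => ?_
    have hd : discrim (‖x‖ ^ 2 / (2 * N)) (-(y x)) C ≤ 0 := by
      refine discrim_le_zero fun t => ?_
      have := h (t • x)
      simp only [map_smul, smul_eq_mul, norm_smul, mul_pow, Real.norm_eq_abs, sq_abs] at this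
      have e : t ^ 2 * ‖x‖ ^ 2 / (2 * N) = ‖x‖ ^ 2 / (2 * N) * (t * t) := by ring
      linarith
    have hsq : (y x) ^ 2 ≤ (√(2 * C / N) * ‖x‖) ^ 2 := by
      rw [mul_pow, Real.sq_sqrt (by positivity)]
      have e : 4 * (‖x‖ ^ 2 / (2 * N)) * C = 2 * C / N * ‖x‖ ^ 2 := by field_simp; ring
      unfold discrim at hd
      linarith [neg_sq (y x)]
    rw [Real.norm_eq_abs]
    exact abs_le_of_sq_le_sq hsq (by positivity)
  have h2 : ‖y‖ ^ 2 ≤ 2 * C / N := by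
    rw [← Real.sq_sqrt (show 0 ≤ 2 * C / N by positivity)]
    gcongr
  calc N / 2 * ‖y‖ ^ 2 ≤ N / 2 * (2 * C / N) := by gcongr
    _ = C := by field_simp

theorem sq_norm_convex_comb_le {E : Type*} [NormedAddCommGroup E] [NormedSpace ℝ E] (u v : E)
    {a b : ℝ} (ha : 0 ≤ a) (hb : 0 ≤ b) (hab : a + b = 1) :
    ‖a • u + b • v‖ ^ 2 ≤ a * ‖u‖ ^ 2 + b * ‖v‖ ^ 2 := by
  have h1 : ‖a • u + b • v‖ ≤ a * ‖u‖ + b * ‖v‖ := by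
    refine (norm_add_le _ _).trans_eq ?_
    rw [norm_smul, norm_smul, Real.norm_of_nonneg ha, Real.norm_of_nonneg hb]
  have hb' : b = 1 - a := by linarith
  calc ‖a • u + b • v‖ ^ 2 ≤ (a * ‖u‖ + b * ‖v‖) ^ 2 := by gcongr
    _ ≤ a * ‖u‖ ^ 2 + b * ‖v‖ ^ 2 := by
      have := mul_nonneg (mul_nonneg ha hb) (sq_nonneg (‖u‖ - ‖v‖))
      subst hb'
      nlinarith

/-- Penalty functional on `X × X* × ℝ × ℝ`. -/
noncomputable def penalty (zs : StrongDual ℝ X) (N s : ℝ) (e : X × StrongDual ℝ X × ℝ × ℝ) : ℝ :=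
  e.2.2.1 + max 0 (-e.2.2.2 - 1) + ‖e.1‖ ^ 2 / (2 * N) + N / 2 * ‖e.2.1 - s • zs‖ ^ 2 + s

theorem penalty_convex_comb_le (zs : StrongDual ℝ X) {N : ℝ} (hN : 0 < N) (s t : ℝ)
    (d e : X × StrongDual ℝ X × ℝ × ℝ) {a b : ℝ} (ha : 0 ≤ a) (hb : 0 ≤ b) (hab : a + b = 1) :
    penalty zs N (a * s + b * t) (a • d + b • e) ≤ a * penalty zs N s d + b * penalty zs N t e := by
  have h1 := sq_norm_convex_comb_le d.1 e.1 ha hb hab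
  have h2 := sq_norm_convex_comb_le (d.2.1 - s • zs) (e.2.1 - t • zs) ha hb hab
  have e2 : a • (d.2.1 - s • zs) + b • (e.2.1 - t • zs)
      = (a • d.2.1 + b • e.2.1) - (a * s + b * t) • zs := by module
  rw [e2] at h2
  have h3 : max 0 (-(a * d.2.2.2 + b * e.2.2.2) - 1)
      ≤ a * max 0 (-d.2.2.2 - 1) + b * max 0 (-e.2.2.2 - 1) := by
    refine max_le (by positivity) ?_
    have := mul_le_mul_of_nonneg_left (le_max_right 0 (-d.2.2.2 - 1)) ha
    have := mul_le_mul_of_nonneg_left (le_max_right 0 (-e.2.2.2 - 1)) hb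
    linarith
  have h1' : ‖a • d.1 + b • e.1‖ ^ 2 / (2 * N)
      ≤ a * (‖d.1‖ ^ 2 / (2 * N)) + b * (‖e.1‖ ^ 2 / (2 * N)) := by
    calc _ ≤ (a * ‖d.1‖ ^ 2 + b * ‖e.1‖ ^ 2) / (2 * N) := by gcongr
      _ = _ := by ring
  have h2' := mul_le_mul_of_nonneg_left h2 (half_pos hN).le
  simp only [penalty, Prod.fst_add, Prod.snd_add, Prod.smul_fst, Prod.smul_snd, smul_eq_mul]
  linarith

/-- Fenchel duality for a set of negative infimum type: the convex envelope of the pairing plus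
the penalty attached to the segment `[0, zs]` has infimum at most `0`. -/
theorem NegInf.exists_penalty_lt {S : Set (X × StrongDual ℝ X)} (hS : NegInf S)
    (zs : StrongDual ℝ X) {N η : ℝ} (hN : 0 < N) (hη : 0 < η) :
    ∃ k ∈ pairingHull S, ∃ s ∈ Set.Icc (0 : ℝ) 1,
      penalty zs N s (k.1, k.2.1, k.2.2, zs k.1) < η := by
  by_contra! hcon
  set O : Set (X × StrongDual ℝ X × ℝ × ℝ) :=
    ⋃ s ∈ Set.Icc (0 : ℝ) 1, {e | penalty zs N s e < η} with hO
  set K : Set (X × StrongDual ℝ X × ℝ × ℝ) :=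
    {e | (e.1, e.2.1, e.2.2.1) ∈ pairingHull S ∧ e.2.2.2 = zs e.1} with hK
  have memO : ∀ e, e ∈ O ↔ ∃ s ∈ Set.Icc (0 : ℝ) 1, penalty zs N s e < η := by
    intro e; simp [hO]
  have hOo : IsOpen O := by
    refine isOpen_biUnion fun s _ => isOpen_lt ?_ continuous_const
    unfold penalty
    fun_prop
  have hOc : Convex ℝ O := by
    intro d hd e he a b ha hb hab
    obtain ⟨s, hs, hds⟩ := (memO d).1 hd
    obtain ⟨t, ht, het⟩ := (memO e).1 he
    refine (memO _).2 ⟨a * s + b * t, convex_Icc 0 1 hs ht ha hb hab,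
      (penalty_convex_comb_le zs hN s t d e ha hb hab).trans_lt ?_⟩
    have hb' : b = 1 - a := by linarith
    rcases ha.eq_or_lt with h | h
    · subst h; simp at hb'; subst hb'; simpa using het
    · nlinarith [mul_lt_mul_of_pos_left hds h, mul_le_mul_of_nonneg_left het.le hb]
  have hKc : Convex ℝ K := by
    intro d hd e he a b ha hb hab
    refine ⟨(convex_convexHull ℝ _ : Convex ℝ (pairingHull S)) hd.1 he.1 ha hb hab, ?_⟩
    have h1 := hd.2
    have h2 := he.2
    simp only [Prod.fst_add, Prod.snd_add, Prod.smul_fst, Prod.smul_snd, smul_eq_mul, map_add,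
      map_smul, h1, h2]
  have hdisj : Disjoint O K := by
    rw [Set.disjoint_left]
    rintro ⟨x, xs, r, β⟩ he ⟨hk, hβ⟩
    obtain ⟨s, hs, hlt⟩ := (memO _).1 he
    simp only at hβ
    subst hβ
    exact absurd hlt (not_lt.2 (hcon _ hk s hs))
  obtain ⟨f, c, hfO, hfK⟩ := geometric_hahn_banach_open hOc hOo hKc hdisj
  obtain ⟨ys, f2, hf1⟩ := exists_dual_prod f
  obtain ⟨yss, f3, hf2⟩ := exists_dual_prod f2
  obtain ⟨ft, fτ, hf3⟩ := exists_dual_prod f3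
  set t := ft 1
  set τ := fτ 1
  have hf : ∀ x xs r β, f (x, xs, r, β) = ys x + yss xs + t * r + τ * β := by
    intro x xs r β
    rw [hf1, hf2, hf3, dual_real_apply ft, dual_real_apply fτ]
    ring
  have hO' : ∀ x xs β, ∀ s ∈ Set.Icc (0 : ℝ) 1, ∀ δ > 0,
      ys x + yss (xs + s • zs) + t * (η - δ - max 0 (-β - 1) - ‖x‖ ^ 2 / (2 * N)
        - N / 2 * ‖xs‖ ^ 2 - s) + τ * β < c := by
    intro x xs β s hs δ hδ
    rw [← hf]
    refine hfO _ ((memO _).2 ⟨s, hs, ?_⟩)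
    simp only [penalty, add_sub_cancel_right]
    linarith
  have hSK : ∀ q ∈ S, c ≤ (ys + τ • zs) q.1 + yss q.2 + t * q.2 q.1 := by
    intro q hq
    have : (q.1, q.2, q.2 q.1, zs q.1) ∈ K := ⟨subset_pairingHull hq, rfl⟩
    have := hfK _ this
    rw [hf] at this
    simp only [add_apply, smul_apply, smul_eq_mul]
    linarith
  have unbounded : ∀ p q d : ℝ, (∀ m : ℝ, 0 ≤ m → p * m + q < d) → p ≤ 0 := by
    intro p q d h
    by_contra! hp
    have := h (|d - q| / p) (by positivity)
    rw [mul_div_cancel₀ _ hp.ne'] at this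
    linarith [le_abs_self (d - q)]
  have ht0 : 0 ≤ t := by
    have := unbounded (-t) (t * (η - 1) - τ) c fun m hm => by
      have := hO' 0 0 (-1) 0 (by simp) (m + 1) (by linarith)
      simp at this
      linarith
    linarith
  have ht : 0 < t := by
    refine ht0.lt_of_ne' fun h0 => ?_
    obtain ⟨q, hq, -⟩ := hS 0 0 1 one_pos
    have h1 := hSK q hq
    have h2 := hO' q.1 q.2 (zs q.1) 0 (by simp) 1 one_pos
    simp only [h0, add_apply, smul_apply, smul_eq_mul, zero_smul, add_zero, zero_mul] at h1 h2
    linarith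
  have hτ : τ ≤ 0 := by
    refine unbounded τ (t * (η - 1)) c fun m hm => ?_
    have := hO' 0 0 m 0 (by simp) 1 one_pos
    rw [max_eq_left (by linarith)] at this
    simp at this
    linarith
  have hτt : -(t + τ) ≤ 0 := by
    refine unbounded _ (t * (η - 1) - τ) c fun m hm => ?_
    have := hO' 0 0 (-1 - m) 0 (by simp) 1 one_pos
    rw [max_eq_right (by linarith)] at this
    simp at this
    linarith
  set σ := -τ / t with hσ
  have hστ : τ = -(t * σ) := by rw [hσ]; field_simp
  have hσm : σ ∈ Set.Icc (0 : ℝ) 1 :=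
    ⟨div_nonneg (by linarith) ht0, (div_le_one ht).2 (by linarith)⟩
  set v : StrongDual ℝ X := -(t⁻¹ • ys) with hv
  have hys : ys = -(t • v) := by rw [hv, smul_neg, smul_inv_smul₀ ht.ne', neg_neg]
  have hc := hS.mul_le ht hSK
  have hc' : c ≤ yss (v + σ • zs) := by
    have e : -yss (ys + τ • zs) = yss (v + σ • zs) * t := by
      rw [hys, hστ]
      simp only [map_add, map_neg, map_smul, smul_eq_mul]
      ring
    rw [e] at hc
    exact le_of_mul_le_mul_right hc ht
  have key := half_mul_sq_norm_le (y := -v) (N := N) (C := N / 2 * ‖v‖ ^ 2 - η / 2) hN fun x => by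
    have := hO' x v (-1) σ hσm (η / 2) (half_pos hη)
    have h2 : ys x = -(t * v x) := by rw [hys]; simp
    simp only [neg_neg, sub_self, max_self] at this
    rw [h2] at this
    have h3 : t * (-v x - ‖x‖ ^ 2 / (2 * N)) < t * (N / 2 * ‖v‖ ^ 2 - η / 2) := by
      rw [hστ] at this
      linarith
    simpa using (lt_of_mul_lt_mul_left h3 ht0).le
  rw [norm_neg] at key
  linarith

theorem NegInf.exists_step {S : Set (X × StrongDual ℝ X)} (hS : NegInf S) (hm : MonotoneSet S)
    {k : X × StrongDual ℝ X × ℝ} (hk : k ∈ pairingHull S) {ε η : ℝ}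
    (hε : k.2.2 - k.2.1 k.1 < ε) (hη : 0 < η) :
    ∃ l ∈ pairingHull S, l.2.2 - l.2.1 l.1 < η ∧
      ‖l.1 - k.1‖ ^ 2 + ‖l.2.1 - k.2.1‖ ^ 2 < 2 * (ε + η) := by
  obtain ⟨u, hu, s, hs, hlt⟩ :=
    (hS.translate (k.1, k.2.1)).exists_penalty_lt 0 (N := 1) one_pos hη
  have hl := mem_pairingHull_of_translate _ hu
  have hpair := hm.pairing_le hk hl
  have hs0 := hs.1
  simp only [penalty, smul_zero, sub_zero] at hlt
  have hmax := le_max_left 0 (-((0 : StrongDual ℝ X) u.1) - 1)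
  have hop : -(u.2.1 u.1) ≤ ‖u.2.1‖ * ‖u.1‖ :=
    (neg_le_abs _).trans (u.2.1.le_opNorm u.1)
  refine ⟨_, hl, ?_, ?_⟩
  · simp only [map_add, add_apply]
    nlinarith [sq_nonneg (‖u.2.1‖ - ‖u.1‖)]
  · simp only [map_add, add_apply, add_sub_cancel_right] at hpair ⊢
    linarith

theorem tendsto_dual_apply {ι : Type*} {l : Filter ι} {f : ι → StrongDual ℝ X} {g : StrongDual ℝ X}
    {a : ι → X} {x : X} (hf : Tendsto f l (𝓝 g)) (ha : Tendsto a l (𝓝 x)) :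
    Tendsto (fun i => f i (a i)) l (𝓝 (g x)) :=
  (isBoundedBilinearMap_apply.continuous.tendsto (g, x)).comp (hf.prodMk_nhds ha)

/-- A Brøndsted–Rockafellar theorem: a point of the pairing hull which almost attains the
pairing is close to the set. -/
theorem NegInf.exists_near [CompleteSpace X] {S : Set (X × StrongDual ℝ X)} (hS : NegInf S)
    (hm : MonotoneSet S)
    (hmax : ∀ p : X × StrongDual ℝ X, (∀ q ∈ S, 0 ≤ (p.2 - q.2) (p.1 - q.1)) → p ∈ S)
    {k : X × StrongDual ℝ X × ℝ} (hk : k ∈ pairingHull S) {ε : ℝ} (hε0 : 0 < ε)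
    (hε : k.2.2 - k.2.1 k.1 < ε) :
    ∃ q ∈ S, ‖q.1 - k.1‖ ≤ 4 * √ε ∧ ‖q.2 - k.2.1‖ ≤ 4 * √ε := by
  have step : ∀ n : ℕ, ∀ l : X × StrongDual ℝ X × ℝ,
      (l ∈ pairingHull S ∧ l.2.2 - l.2.1 l.1 < ε * (1 / 4) ^ n) →
      ∃ l' : X × StrongDual ℝ X × ℝ,
        (l' ∈ pairingHull S ∧ l'.2.2 - l'.2.1 l'.1 < ε * (1 / 4) ^ (n + 1)) ∧
        ‖l'.1 - l.1‖ ≤ 2 * √ε * (1 / 2) ^ n ∧ ‖l'.2.1 - l.2.1‖ ≤ 2 * √ε * (1 / 2) ^ n := by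
    rintro n l ⟨hl, hlt⟩
    obtain ⟨l', hl', h1, h2⟩ := hS.exists_step hm hl hlt
      (show 0 < ε * (1 / 4) ^ (n + 1) by positivity)
    have hsq : (2 * √ε * (1 / 2) ^ n) ^ 2 = 4 * (ε * (1 / 4) ^ n) := by
      rw [mul_pow, mul_pow, Real.sq_sqrt hε0.le, ← pow_mul, mul_comm n 2, pow_mul]
      norm_num
      ring
    have hp : 0 < ε * (1 / 4) ^ n := by positivity
    rw [pow_succ (1 / 4 : ℝ) n] at h2
    refine ⟨l', ⟨hl', h1⟩, ?_, ?_⟩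
    · refine abs_le_of_sq_le_sq' ?_ (by positivity) |>.2
      nlinarith [sq_nonneg ‖l'.2.1 - l.2.1‖]
    · refine abs_le_of_sq_le_sq' ?_ (by positivity) |>.2
      nlinarith [sq_nonneg ‖l'.1 - l.1‖]
  choose! g hg hg1 hg2 using step
  let a : ℕ → X × StrongDual ℝ X × ℝ := fun n => Nat.rec k g n
  have ha : ∀ n, a n ∈ pairingHull S ∧ (a n).2.2 - (a n).2.1 (a n).1 < ε * (1 / 4) ^ n := by
    intro n
    induction n with
    | zero => exact ⟨hk, by simpa [a] using hε⟩
    | succ n ih => exact hg n _ ih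
  let b : ℕ → X × StrongDual ℝ X := fun n => ((a n).1, (a n).2.1)
  have hb : ∀ n, dist (b n) (b (n + 1)) ≤ 2 * √ε * (1 / 2) ^ n := by
    intro n
    rw [dist_comm, dist_eq_norm, Prod.norm_def]
    exact max_le (hg1 n _ (ha n)) (hg2 n _ (ha n))
  obtain ⟨q, hq⟩ := cauchySeq_tendsto_of_complete
    (cauchySeq_of_le_geometric (1 / 2) (2 * √ε) (by norm_num) hb)
  have hdist := dist_le_of_le_geometric_of_tendsto₀ (1 / 2) (2 * √ε) (by norm_num) hb hq
  rw [dist_comm, dist_eq_norm, Prod.norm_def] at hdist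
  have e4 : 2 * √ε / (1 - 1 / 2) = 4 * √ε := by ring
  rw [e4] at hdist
  refine ⟨q, hmax q fun p hp => ?_, (le_max_left _ _).trans hdist, (le_max_right _ _).trans hdist⟩
  have hq1 : Tendsto (fun n => (a n).1) atTop (𝓝 q.1) := (continuous_fst.tendsto q).comp hq
  have hq2 : Tendsto (fun n => (a n).2.1) atTop (𝓝 q.2) := (continuous_snd.tendsto q).comp hq
  have hle : ∀ n, p.2 (a n).1 + (a n).2.1 p.1 - p.2 p.1
      ≤ (a n).2.1 (a n).1 + ε * (1 / 4) ^ n := by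
    intro n
    have := fitzpatrick_le_of_mem_pairingHull p (fun r hr => hm r hr p hp) (ha n).1
    linarith [(ha n).2]
  have hlim : p.2 q.1 + q.2 p.1 - p.2 p.1 ≤ q.2 q.1 + ε * 0 := by
    refine le_of_tendsto_of_tendsto' (b := atTop) ?_ ?_ hle
    · exact (((p.2.continuous.tendsto _).comp hq1).add (tendsto_dual_apply hq2 tendsto_const_nhds)).sub_const _
    · exact (tendsto_dual_apply hq2 hq1).add
        ((tendsto_pow_atTop_nhds_zero_of_lt_one (by norm_num) (by norm_num)).const_mul _)
  simp only [map_sub, sub_apply]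
  linarith

/-- Goldstine's theorem for finitely many functionals. -/
theorem exists_norm_lt_forall_abs_lt (xss : StrongDual ℝ (StrongDual ℝ X)) {M : ℝ}
    (hM : ‖xss‖ < M) (F : Finset (StrongDual ℝ X)) {η : ℝ} (hη : 0 < η) :
    ∃ x : X, ‖x‖ < M ∧ ∀ y ∈ F, |y x - xss y| < η := by
  classical
  have hM0 : 0 < M := lt_of_le_of_lt (norm_nonneg xss) hM
  let L : X →ₗ[ℝ] (F → ℝ) := LinearMap.pi fun y => (y : StrongDual ℝ X).toLinearMap
  have hL : ∀ x y, L x y = (y : StrongDual ℝ X) x := fun x y => rfl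
  let v : F → ℝ := fun y => xss y
  suffices h : v ∈ closure (L '' Metric.ball 0 M) by
    obtain ⟨_, ⟨x, hx, rfl⟩, hd⟩ := Metric.mem_closure_iff.1 h η hη
    refine ⟨x, by simpa using hx, fun y hy => ?_⟩
    have := (dist_pi_lt_iff hη).1 hd ⟨y, hy⟩
    rwa [dist_comm, Real.dist_eq] at this
  by_contra hv
  obtain ⟨f, c, hf1, hf2⟩ := geometric_hahn_banach_closed_point
    ((convex_ball (0 : X) M).linear_image L).closure isClosed_closure hv
  let φ : StrongDual ℝ X := ∑ y : F, f (Pi.single y 1) • (y : StrongDual ℝ X)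
  have hfw : ∀ w : F → ℝ, f w = ∑ y, f (Pi.single y 1) * w y := by
    intro w
    have := LinearMap.pi_apply_eq_sum_univ f.toLinearMap w
    simp only [ContinuousLinearMap.coe_coe, smul_eq_mul] at this
    rw [this]
    refine Finset.sum_congr rfl fun y _ => ?_
    rw [mul_comm]
    congr 2
    ext i
    simp [Pi.single_apply, eq_comm]
  have hφ : ∀ x, f (L x) = φ x := by
    intro x
    rw [hfw]
    simp [φ, hL]
  have hφv : f v = xss φ := by
    rw [hfw]
    simp [φ, v]
  have hlt : ∀ x, ‖x‖ < M → φ x < xss φ := by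
    intro x hx
    rw [← hφ, ← hφv]
    exact (hf1 _ (subset_closure ⟨x, by simpa using hx, rfl⟩)).trans hf2
  have hpos : 0 < xss φ := by simpa using hlt 0 (by simpa using hM0)
  have hle : xss φ ≤ ‖xss‖ * ‖φ‖ := (le_abs_self _).trans (xss.le_opNorm φ)
  have hφ0 : 0 < ‖φ‖ := by
    by_contra! h0
    have : ‖φ‖ = 0 := le_antisymm h0 (norm_nonneg _)
    rw [this] at hle
    linarith
  have hdiv : xss φ / M < ‖φ‖ := by
    rw [div_lt_iff₀ hM0]
    nlinarith
  obtain ⟨x, hx, hxlt⟩ := φ.exists_lt_apply_of_lt_opNorm hdiv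
  rw [div_lt_iff₀ hM0, Real.norm_eq_abs] at hxlt
  have hb : ‖M • x‖ < M := by
    rw [norm_smul, Real.norm_of_nonneg hM0.le]
    nlinarith
  have h1 := hlt (M • x) hb
  have h2 := hlt (-(M • x)) (by rwa [norm_neg])
  simp only [map_neg, map_smul, smul_eq_mul] at h1 h2
  rcases abs_cases (φ x) with ⟨h, -⟩ | ⟨h, -⟩ <;> rw [h] at hxlt <;> linarith

theorem NegInf.exists_pairingHull_near {S : Set (X × StrongDual ℝ X)} (hS : NegInf S)
    {xss : StrongDual ℝ (StrongDual ℝ X)} {xs : StrongDual ℝ X}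
    (hrel : ∀ q ∈ S, 0 ≤ (q.2 - xs) q.1 - xss (q.2 - xs)) {M : ℝ} (hM : ‖xss‖ < M)
    (F : Finset (StrongDual ℝ X)) {η : ℝ} (hη : 0 < η) :
    ∃ k ∈ pairingHull S, ‖k.1‖ < M ∧ (∀ y ∈ F, |y k.1 - xss y| < η) ∧ ‖k.2.1 - xs‖ < η ∧
      k.2.2 < xss xs + η := by
  classical
  by_contra! hcon
  set V : Set X := Metric.ball 0 M ∩ ⋂ y ∈ F, (fun x => y x - xss y) ⁻¹' Metric.ball 0 η with hV
  have hVo : IsOpen V := Metric.isOpen_ball.inter (isOpen_biInter_finset fun y _ =>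
    Metric.isOpen_ball.preimage (by fun_prop))
  have memV : ∀ x, x ∈ V ↔ ‖x‖ < M ∧ ∀ y ∈ F, |y x - xss y| < η := by
    intro x; simp [hV]
  have hVc : Convex ℝ V := by
    refine (convex_ball _ _).inter (convex_iInter₂ fun y _ => ?_)
    intro p hp q hq a b ha hb hab
    have := convex_ball (0 : ℝ) η hp hq ha hb hab
    have e : y (a • p + b • q) - xss y = a • (y p - xss y) + b • (y q - xss y) := by
      have hb' : b = 1 - a := by linarith
      subst hb'
      simp only [map_add, map_smul, smul_eq_mul]
      ring
    simpa only [Set.mem_preimage, e] using this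
  set O : Set (X × StrongDual ℝ X × ℝ) := V ×ˢ (Metric.ball xs η ×ˢ Set.Iio (xss xs + η)) with hO
  have hOo : IsOpen O := hVo.prod (Metric.isOpen_ball.prod isOpen_Iio)
  have hOc : Convex ℝ O := hVc.prod ((convex_ball _ _).prod (convex_Iio _))
  have hdisj : Disjoint O (pairingHull S) := by
    rw [Set.disjoint_left]
    rintro k ⟨h1, h2, h3⟩ hk
    obtain ⟨h4, h5⟩ := (memV _).1 h1
    rw [mem_ball_iff_norm] at h2
    exact absurd h3 (not_lt.2 (hcon k hk h4 h5 h2))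
  obtain ⟨f, c, hfO, hfK⟩ := geometric_hahn_banach_open hOc hOo (convex_convexHull ℝ _) hdisj
  obtain ⟨ys, f2, hf1⟩ := exists_dual_prod f
  obtain ⟨yss, ft, hf2⟩ := exists_dual_prod f2
  set t := ft 1
  have hf : ∀ x us r, f (x, us, r) = ys x + yss us + t * r := by
    intro x us r
    rw [hf1, hf2, dual_real_apply ft]
    ring
  have hO' : ∀ x ∈ V, ∀ r < xss xs + η, ys x + yss xs + t * r < c := by
    intro x hx r hr
    rw [← hf]
    exact hfO _ ⟨hx, Metric.mem_ball_self hη, hr⟩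
  have hSK : ∀ q ∈ S, c ≤ ys q.1 + yss q.2 + t * q.2 q.1 := by
    intro q hq
    rw [← hf]
    exact hfK _ (subset_pairingHull hq)
  obtain ⟨x₀, hx₀⟩ : V.Nonempty := by
    obtain ⟨x, h⟩ := exists_norm_lt_forall_abs_lt xss hM F hη
    exact ⟨x, (memV x).2 h⟩
  have ht : 0 ≤ t := by
    by_contra! ht
    have := hO' x₀ hx₀ (min (xss xs) ((c - ys x₀ - yss xs) / t)) (by
      have := min_le_left (xss xs) ((c - ys x₀ - yss xs) / t)
      linarith)
    have h2 := mul_le_mul_of_nonpos_left (min_le_right (xss xs) ((c - ys x₀ - yss xs) / t)) ht.le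
    rw [mul_div_cancel₀ _ ht.ne] at h2
    linarith
  have hbound : ∀ m : ℝ, 0 < m →
      m * (c - t * xss xs - xss ys - yss xs) ≤ -yss ys - c * t := by
    intro m hm
    have := hS.mul_le (ys := ys - m • xs) (yss := yss - m • xss) (t := t + m)
      (c := c - m * xss xs) (by linarith) fun q hq => by
        have h1 := hSK q hq
        have h2 := mul_le_mul_of_nonneg_left (hrel q hq) hm.le
        simp only [sub_apply, smul_apply, map_sub, smul_eq_mul] at h2 ⊢
        linarith
    simp only [sub_apply, smul_apply, map_sub, map_smul, smul_eq_mul] at this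
    linarith
  have hc : c ≤ t * xss xs + xss ys + yss xs := by
    by_contra! h
    have h0 : 0 < c - t * xss xs - xss ys - yss xs := by linarith
    have := hbound ((|-yss ys - c * t| + 1) / (c - t * xss xs - xss ys - yss xs)) (by positivity)
    rw [div_mul_cancel₀ _ h0.ne'] at this
    linarith [le_abs_self (-yss ys - c * t)]
  have hx : ∃ x ∈ V, xss ys ≤ ys x := by
    by_cases hy : ys = 0
    · exact ⟨x₀, hx₀, by simp [hy]⟩
    obtain ⟨z, hz⟩ : ∃ z, 0 < ys z := by
      by_contra! h
      refine hy (ContinuousLinearMap.ext fun z => le_antisymm (h z) ?_)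
      have := h (-z)
      rw [map_neg] at this
      simpa using this
    obtain ⟨M', hM1, hM2⟩ := exists_between hM
    set C := 1 + ‖z‖ + ∑ y ∈ F, ‖y‖ * ‖z‖
    have hsum : 0 ≤ ∑ y ∈ F, ‖y‖ * ‖z‖ := Finset.sum_nonneg fun y _ => by positivity
    have hC : 0 < C := by positivity
    have hmin : 0 < min (M - M') (η / 2) := lt_min (by linarith) (by linarith)
    set δ := min (M - M') (η / 2) / C with hδ
    have hδ0 : 0 < δ := div_pos hmin hC
    have hδC : δ * C = min (M - M') (η / 2) := div_mul_cancel₀ _ hC.ne'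
    obtain ⟨x₁, hx1, hx1F⟩ := exists_norm_lt_forall_abs_lt xss hM1 (insert ys F)
      (lt_min (half_pos hη) (mul_pos hδ0 hz))
    refine ⟨x₁ + δ • z, (memV _).2 ⟨?_, fun y hy => ?_⟩, ?_⟩
    · have h1 : δ * ‖z‖ ≤ δ * C :=
        mul_le_mul_of_nonneg_left (by simp only [C]; linarith) hδ0.le
      have h2 := norm_add_le x₁ (δ • z)
      rw [norm_smul, Real.norm_of_nonneg hδ0.le] at h2
      linarith [min_le_left (M - M') (η / 2)]
    · have h1 := (hx1F y (Finset.mem_insert_of_mem hy)).trans_le (min_le_left _ _)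
      have h2 : ‖y‖ * ‖z‖ ≤ ∑ y ∈ F, ‖y‖ * ‖z‖ :=
        Finset.single_le_sum (f := fun y : StrongDual ℝ X => ‖y‖ * ‖z‖)
          (fun y _ => by positivity) hy
      have h3 : |y z| ≤ C := (y.le_opNorm z).trans (by simp only [C]; linarith [norm_nonneg z])
      have h4 := mul_le_mul_of_nonneg_left h3 hδ0.le
      have h5 := abs_add_le (y x₁ - xss y) (δ * y z)
      rw [abs_mul, abs_of_pos hδ0] at h5
      have e : y (x₁ + δ • z) - xss y = y x₁ - xss y + δ * y z := by
        simp only [map_add, map_smul, smul_eq_mul]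
        ring
      rw [e]
      linarith [min_le_right (M - M') (η / 2)]
    · have h1 := (hx1F ys (Finset.mem_insert_self _ _)).trans_le (min_le_right _ _)
      simp only [map_add, map_smul, smul_eq_mul]
      linarith [neg_abs_le (ys x₁ - xss ys)]
  obtain ⟨x, hxV, hx⟩ := hx
  have := hO' x hxV (xss xs) (by linarith)
  linarith

theorem eventually_const_mul_lt (C : ℝ) {c : ℝ} (hc : 0 < c) : ∀ᶠ δ in 𝓝[>] (0 : ℝ), C * δ < c := by
  have h : Tendsto (fun δ : ℝ => C * δ) (𝓝[>] 0) (𝓝 (C * 0)) :=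
    ((continuous_const_mul C).tendsto 0).mono_left nhdsWithin_le_nhds
  rw [mul_zero] at h
  exact h.eventually_lt_const hc

/-- If the pairing is nonnegative on `S` near the segment `[0, z*]`, for some `(z, z*) ∈ S`, then
the penalized points of the pairing hull approach the origin. -/
theorem NegInf.exists_approx_zero [CompleteSpace X] {S : Set (X × StrongDual ℝ X)}
    (hS : NegInf S) (hm : MonotoneSet S)
    (hmax : ∀ p : X × StrongDual ℝ X, (∀ q ∈ S, 0 ≤ (p.2 - q.2) (p.1 - q.1)) → p ∈ S)
    {z : X × StrongDual ℝ X} (hz : z ∈ S) {ρ : ℝ} (hρ : 0 < ρ)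
    (hnear : ∀ q ∈ S, ∀ s ∈ Set.Icc (0 : ℝ) 1, ‖q.2 - s • z.2‖ < ρ → 0 ≤ q.2 q.1) :
    ∃ N > 0, ∃ R > 0, ∀ δ > 0, δ < 1 → 8 * δ < ρ → 4 * δ < 1 → ∃ k ∈ pairingHull S, ∃ s : ℝ,
      0 ≤ s ∧ k.2.2 < δ ∧ s < (1 + 4 * R) * δ ∧ ‖k.1‖ ^ 2 < 2 * N * (1 + 4 * R) * δ ∧
      ‖k.2.1 - s • z.2‖ ^ 2 < 2 / N * (1 + 4 * R) * δ := by
  obtain ⟨α, hαdef⟩ : ∃ α, α = ‖z.1‖ := ⟨_, rfl⟩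
  obtain ⟨c, hcdef⟩ : ∃ c, c = ‖z.2‖ * ‖z.1‖ := ⟨_, rfl⟩
  have hα : 0 ≤ α := hαdef ▸ norm_nonneg _
  have hc : 0 ≤ c := by rw [hcdef]; positivity
  obtain ⟨N, hN⟩ : ∃ N, N = 4 / ρ * (α + 2 * (c + 2) / ρ) := ⟨_, rfl⟩
  have hN0 : 0 < N := by rw [hN]; positivity
  obtain ⟨B, hBdef⟩ : ∃ B, B = 2 * N * (α * (ρ / 2) + c + 2) + 1 := ⟨_, rfl⟩
  have hB0 : 0 < B := by rw [hBdef]; positivity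
  obtain ⟨R, hRdef⟩ : ∃ R, R = B + (‖z.2‖ + ρ) + 1 := ⟨_, rfl⟩
  have hR : 0 < R := by rw [hRdef]; positivity
  refine ⟨N, hN0, R, hR, ?_⟩
  intro δ hδ hδ1 hδρ hδ4
  have hη : 0 < δ ^ 2 := by positivity
  have hηδ : δ ^ 2 < δ := by nlinarith
  obtain ⟨k, hk, s, hs, hlt⟩ := hS.exists_penalty_lt z.2 hN0 hη
  simp only [penalty] at hlt
  have hfz := fitzpatrick_le_of_mem_pairingHull z (fun q hq => hm q hq z hz) hk
  set x := k.1
  set v := k.2.1 - s • z.2 with hv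
  have hkv : k.2.1 = s • z.2 + v := by rw [hv]; abel
  set m := max 0 (-z.2 x - 1)
  have hm0 : 0 ≤ m := le_max_left _ _
  have hm1 : -z.2 x - 1 ≤ m := le_max_right _ _
  have hx0 : 0 ≤ ‖x‖ ^ 2 / (2 * N) := by positivity
  have hv0 : 0 ≤ N / 2 * ‖v‖ ^ 2 := by positivity
  have hva : -v z.1 ≤ ‖v‖ * α := hαdef ▸ (neg_le_abs _).trans (v.le_opNorm _)
  have hza : (1 - s) * z.2 z.1 ≤ c := by
    have h1 : z.2 z.1 ≤ c := hcdef ▸ (le_abs_self _).trans (z.2.le_opNorm _)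
    calc (1 - s) * z.2 z.1 ≤ (1 - s) * c :=
          mul_le_mul_of_nonneg_left h1 (sub_nonneg.2 hs.2)
      _ ≤ c := by nlinarith [hs.1]
  have hest : ‖x‖ ^ 2 / (2 * N) + N / 2 * ‖v‖ ^ 2 < ‖v‖ * α + c + 2 := by
    rw [hkv] at hfz
    simp only [add_apply, smul_apply, smul_eq_mul] at hfz
    linarith [hs.1]
  have hvρ : ‖v‖ < ρ / 2 := by
    by_contra! h
    have h1 : N * ρ / 4 = α + 2 * (c + 2) / ρ := by rw [hN]; field_simp
    have h2 : c + 2 ≤ 2 * (c + 2) / ρ * ‖v‖ := by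
      calc c + 2 = 2 * (c + 2) / ρ * (ρ / 2) := by field_simp
        _ ≤ _ := by gcongr
    have h3 : N * ρ / 4 * ‖v‖ ≤ N / 2 * ‖v‖ ^ 2 := by
      have := mul_le_mul_of_nonneg_left h (show 0 ≤ N / 2 * ‖v‖ by positivity)
      linarith [sq ‖v‖]
    rw [h1] at h3
    linarith
  have hxB : ‖x‖ ≤ B := by
    have h1 : ‖x‖ ^ 2 / (2 * N) ≤ α * (ρ / 2) + c + 2 := by
      have := mul_le_mul_of_nonneg_left hvρ.le hα
      linarith
    rw [div_le_iff₀ (by positivity)] at h1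
    have h2 : ‖x‖ ≤ ‖x‖ ^ 2 + 1 := by nlinarith [sq_nonneg (‖x‖ - 1)]
    linarith
  have hgap : k.2.2 - k.2.1 x < δ ^ 2 := by
    have h1 : -(s * z.2 x) ≤ m + s := by
      have := mul_le_mul_of_nonneg_left hm1 hs.1
      have := mul_le_mul_of_nonneg_right hs.2 hm0
      linarith
    have h2 : -v x ≤ ‖v‖ * ‖x‖ := (neg_le_abs _).trans (v.le_opNorm _)
    have h3 : ‖v‖ * ‖x‖ ≤ ‖x‖ ^ 2 / (2 * N) + N / 2 * ‖v‖ ^ 2 := by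
      have : ‖x‖ ^ 2 / (2 * N) + N / 2 * ‖v‖ ^ 2 - ‖v‖ * ‖x‖
          = (‖x‖ - N * ‖v‖) ^ 2 / (2 * N) := by field_simp; ring
      have : 0 ≤ (‖x‖ - N * ‖v‖) ^ 2 / (2 * N) := by positivity
      linarith
    have h4 : k.2.1 x = s * z.2 x + v x := by rw [hkv]; simp
    linarith
  obtain ⟨q, hq, hq1, hq2⟩ := hS.exists_near hm hmax hk hη hgap
  rw [Real.sqrt_sq hδ.le] at hq1 hq2
  have hq0 : 0 ≤ q.2 q.1 := by
    have e : q.2 - s • z.2 = v + (q.2 - k.2.1) := by rw [hv]; abel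
    refine hnear q hq s hs ?_
    rw [e]
    refine (norm_add_le _ _).trans_lt ?_
    linarith
  have hkn : ‖k.2.1‖ ≤ ‖z.2‖ + ρ := by
    rw [hkv]
    refine (norm_add_le _ _).trans (add_le_add ?_ (by linarith))
    rw [norm_smul, Real.norm_of_nonneg hs.1]
    exact mul_le_of_le_one_left (norm_nonneg _) hs.2
  have hr : -(4 * R * δ) ≤ k.2.2 := by
    have h1 := hm.apply_le hk
    have e : q.2 q.1 = k.2.1 x + k.2.1 (q.1 - x) + (q.2 - k.2.1) x
        + (q.2 - k.2.1) (q.1 - x) := by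
      simp only [map_sub, sub_apply]; ring
    have bd : ∀ (f : StrongDual ℝ X) (y : X) (a b : ℝ), ‖f‖ ≤ a → ‖y‖ ≤ b → f y ≤ a * b :=
      fun f y a b ha hb => (le_abs_self _).trans <| (f.le_opNorm y).trans <|
        mul_le_mul ha hb (norm_nonneg _) ((norm_nonneg _).trans ha)
    have b1 := bd k.2.1 (q.1 - x) _ _ hkn hq1
    have b2 := bd (q.2 - k.2.1) x _ _ hq2 hxB
    have b3 := bd (q.2 - k.2.1) (q.1 - x) _ _ hq2 hq1
    have b4 : 4 * δ * (4 * δ) ≤ 4 * δ * 1 := by gcongr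
    have e2 : 4 * R * δ = 4 * δ * B + (‖z.2‖ + ρ) * (4 * δ) + 4 * δ * 1 := by
      rw [hRdef]; ring
    linarith
  have hs0 := hs.1
  have hT : ‖x‖ ^ 2 / (2 * N) < (1 + 4 * R) * δ := by linarith
  have hT' : N / 2 * ‖v‖ ^ 2 < (1 + 4 * R) * δ := by linarith
  refine ⟨k, hk, s, hs0, by linarith, by linarith, ?_, ?_⟩
  · rw [div_lt_iff₀ (by positivity)] at hT
    linarith
  · have e : 2 / N * (1 + 4 * R) * δ = 2 / N * ((1 + 4 * R) * δ) := by ring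
    have e2 : ‖v‖ ^ 2 = 2 / N * (N / 2 * ‖v‖ ^ 2) := by field_simp
    rw [e, e2]
    gcongr

/-- The Fitzpatrick–Phelps property at the origin for sets of negative infimum type. -/
theorem NegInf.zero_mem_of_nonneg_on [CompleteSpace X] {S : Set (X × StrongDual ℝ X)}
    (hS : NegInf S) (hm : MonotoneSet S)
    (hmax : ∀ p : X × StrongDual ℝ X, (∀ q ∈ S, 0 ≤ (p.2 - q.2) (p.1 - q.1)) → p ∈ S)
    {U : Set (StrongDual ℝ X)} (hUo : IsOpen U) (hUc : Convex ℝ U) (h0 : 0 ∈ U)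
    {z : X × StrongDual ℝ X} (hz : z ∈ S) (hzU : z.2 ∈ U)
    (hU : ∀ q ∈ S, q.2 ∈ U → 0 ≤ q.2 q.1) : (0, 0) ∈ S := by
  obtain ⟨ρ₀, hρ₀, hb0⟩ := Metric.isOpen_iff.1 hUo 0 h0
  obtain ⟨ρ₁, hρ₁, hb1⟩ := Metric.isOpen_iff.1 hUo z.2 hzU
  set ρ := min ρ₀ ρ₁ with hρdef
  have hρ : 0 < ρ := lt_min hρ₀ hρ₁
  have hseg : ∀ s ∈ Set.Icc (0 : ℝ) 1, ∀ v : StrongDual ℝ X, ‖v‖ < ρ → s • z.2 + v ∈ U := by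
    intro s hs v hv
    have h1 : v ∈ U := hb0 (by rw [mem_ball_zero_iff]; exact hv.trans_le (min_le_left _ _))
    have h2 : z.2 + v ∈ U :=
      hb1 (by rw [mem_ball_iff_norm, add_sub_cancel_left]; exact hv.trans_le (min_le_right _ _))
    have := hUc h1 h2 (sub_nonneg.2 hs.2) hs.1 (by ring)
    convert this using 1
    module
  obtain ⟨N, hN0, R, hR, key⟩ := hS.exists_approx_zero hm hmax hz hρ fun q hq s hs hqs =>
    hU q hq (by simpa using hseg s hs _ hqs)
  refine hmax _ fun b hb => ?_
  simp only [zero_sub, map_neg, neg_apply, neg_neg]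
  refine le_of_forall_pos_lt_add fun ε hε => ?_
  set τ := ε / (2 + ‖b.2‖ + ‖b.1‖) with hτ
  have hτ0 : 0 < τ := by positivity
  obtain ⟨δ, hδ0, h1, h2, h3, h4, h5, h6, h7⟩ := ((eventually_mem_nhdsWithin (a := (0 : ℝ))
    (s := Set.Ioi 0)).and <| (eventually_const_mul_lt 1 one_pos).and <|
    (eventually_const_mul_lt 8 hρ).and <| (eventually_const_mul_lt 4 one_pos).and <|
    (eventually_const_mul_lt 1 hτ0).and <|
    (eventually_const_mul_lt (2 * N * (1 + 4 * R)) (pow_pos hτ0 2)).and <|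
    (eventually_const_mul_lt (2 / N * (1 + 4 * R)) (pow_pos (half_pos hτ0) 2)).and <|
    (eventually_const_mul_lt ((1 + 4 * R) * ‖z.2‖) (half_pos hτ0))).exists
  obtain ⟨k, hk, s, hs0, hr, hs, hx, hv⟩ := key δ hδ0 (by linarith) h2 h3
  have hx' : ‖k.1‖ < τ := lt_of_pow_lt_pow_left₀ 2 hτ0.le (hx.trans h5)
  have hv' : ‖k.2.1 - s • z.2‖ < τ / 2 := lt_of_pow_lt_pow_left₀ 2 (half_pos hτ0).le (hv.trans h6)
  have hk2 : ‖k.2.1‖ < τ := by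
    have e : k.2.1 = s • z.2 + (k.2.1 - s • z.2) := by abel
    have := norm_add_le (s • z.2) (k.2.1 - s • z.2)
    rw [← e, norm_smul, Real.norm_of_nonneg hs0] at this
    have := mul_le_mul_of_nonneg_right hs.le (norm_nonneg z.2)
    linarith
  have hfz := fitzpatrick_le_of_mem_pairingHull b (fun q hq => hm q hq b hb) hk
  have b1 : -b.2 k.1 ≤ ‖b.2‖ * τ :=
    (neg_le_abs _).trans ((b.2.le_opNorm _).trans (by gcongr))
  have b2 : -k.2.1 b.1 ≤ τ * ‖b.1‖ :=
    (neg_le_abs _).trans ((k.2.1.le_opNorm _).trans (by gcongr))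
  have e : τ * (2 + ‖b.2‖ + ‖b.1‖) = ε := div_mul_cancel₀ _ (by positivity)
  linarith

theorem MonotoneSet.translate {S : Set (X × StrongDual ℝ X)} (hS : MonotoneSet S)
    (w : X × StrongDual ℝ X) : MonotoneSet (translate S w) := by
  rintro _ ⟨p, hp, rfl⟩ _ ⟨q, hq, rfl⟩
  simpa using hS p hp q hq

theorem IsMaximallyMonotone.mem_graph {A : X → Set (StrongDual ℝ X)} (hA : IsMaximallyMonotone A)
    (p : X × StrongDual ℝ X) (hp : ∀ q ∈ graph A, 0 ≤ (p.2 - q.2) (p.1 - q.1)) : p ∈ graph A := by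
  have hB : graph (fun x => A x ∪ {y | (x, y) = p}) = graph A ∪ {p} := by
    ext q
    simp [graph, or_comm]
  have := hA.2 (fun x => A x ∪ {y | (x, y) = p}) (by
    intro q hq r hr
    rw [hB] at hq hr
    rcases hq with hq | rfl <;> rcases hr with hr | rfl
    · exact hA.1 q hq r hr
    · have := hp q hq
      rw [← neg_sub r.2, ← neg_sub r.1]
      simpa only [map_neg, neg_apply, neg_neg] using this
    · exact hp r hr
    · simp) (by rw [hB]; exact Set.subset_union_left)
  rw [← this, hB]
  exact Or.inr rfl

theorem inclusion_sub_apply (x : X) (xss : StrongDual ℝ (StrongDual ℝ X)) (f : StrongDual ℝ X) :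
    (NormedSpace.inclusionInDoubleDual ℝ X x - xss) f = f x - xss f := by
  rw [sub_apply, NormedSpace.dual_def]

theorem isTypeNI_iff_negInf {A : X → Set (StrongDual ℝ X)} : IsTypeNI A ↔ NegInf (graph A) := by
  constructor
  · intro h xss xs ε hε
    have hlt : graphInf A xss xs < ((ε : ℝ) : EReal) :=
      (h xss xs).trans_lt (by exact_mod_cast hε)
    simp only [graphInf, iInf_lt_iff, EReal.coe_lt_coe_iff, inclusion_sub_apply] at hlt
    obtain ⟨q, hq, hlt⟩ := hlt
    exact ⟨q, hq, hlt⟩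
  · intro h xss xs
    refine EReal.le_of_forall_lt_iff_le.1 fun ε hε => ?_
    obtain ⟨q, hq, hlt⟩ := h xss xs ε (by exact_mod_cast hε)
    refine (iInf₂_le q hq).trans ?_
    rw [inclusion_sub_apply]
    exact_mod_cast hlt.le

theorem le_graphInf_iff {A : X → Set (StrongDual ℝ X)} {xss : StrongDual ℝ (StrongDual ℝ X)}
    {xs : StrongDual ℝ X} {c : ℝ} :
    (c : EReal) ≤ graphInf A xss xs ↔ ∀ q ∈ graph A, c ≤ (q.2 - xs) q.1 - xss (q.2 - xs) := by
  simp only [graphInf, le_iInf_iff, EReal.coe_le_coe_iff, inclusion_sub_apply]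

theorem IsTypeD.negInf {A : X → Set (StrongDual ℝ X)} (hD : IsTypeD A) : NegInf (graph A) := by
  intro xss xs ε hε
  by_contra! hcon
  obtain ⟨Γ, _, _, _, a, as, hgr, ⟨M, hM⟩, -, has⟩ := hD xss xs (by
    rw [← EReal.coe_zero, le_graphInf_iff]
    exact fun q hq => hε.le.trans (hcon q hq))
  have h1 : ∀ γ, ε ≤ (M + ‖xss‖) * ‖as γ - xs‖ := by
    intro γ
    have h2 : (as γ - xs) (a γ) ≤ ‖as γ - xs‖ * ‖a γ‖ :=
      (le_abs_self _).trans ((as γ - xs).le_opNorm _)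
    have h3 : -xss (as γ - xs) ≤ ‖xss‖ * ‖as γ - xs‖ := (neg_le_abs _).trans (xss.le_opNorm _)
    have h4 := mul_le_mul_of_nonneg_left (hM γ).1 (norm_nonneg (as γ - xs))
    have := hcon _ (hgr γ)
    linarith
  have h2 : Tendsto (fun γ => (M + ‖xss‖) * ‖as γ - xs‖) atTop (𝓝 ((M + ‖xss‖) * 0)) :=
    (tendsto_iff_norm_sub_tendsto_zero.1 has).const_mul _
  have := ge_of_tendsto' h2 h1
  linarith

theorem NegInf.isTypeD [CompleteSpace X] {A : X → Set (StrongDual ℝ X)}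
    (hA : IsMaximallyMonotone A) (hN : NegInf (graph A)) : IsTypeD A := by
  classical
  intro xss xs h
  rw [← EReal.coe_zero, le_graphInf_iff] at h
  set M := ‖xss‖ + 1 with hMdef
  have hM : ‖xss‖ < M := lt_add_one _
  have hM0 : 0 < M := lt_of_le_of_lt (norm_nonneg xss) hM
  have key : ∀ (F : Finset (StrongDual ℝ X)) (η : ℝ), 0 < η → ∃ q ∈ graph A,
      ‖q.1‖ ≤ M + η ∧ ‖q.2 - xs‖ ≤ η ∧ ∀ y ∈ F, |y q.1 - xss y| ≤ (1 + ‖y‖) * η := by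
    intro F η hη
    obtain ⟨δ, hδ, hδη⟩ : ∃ δ, 0 < δ ∧ 8 * δ ≤ η := ⟨η / 8, by positivity, by linarith⟩
    set ζ := min (η / 2) (δ ^ 2 / (2 + M)) with hζ
    have hζ0 : 0 < ζ := lt_min (half_pos hη) (by positivity)
    obtain ⟨k, hk, hk1, hkF, hk2, hkr⟩ := hN.exists_pairingHull_near h hM (insert xs F) hζ0
    have hgap : k.2.2 - k.2.1 k.1 < δ ^ 2 := by
      have b1 := neg_le_abs (xs k.1 - xss xs)
      have b2 := hkF xs (Finset.mem_insert_self _ _)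
      have b3 : -(k.2.1 - xs) k.1 ≤ ζ * M :=
        (neg_le_abs _).trans <| ((k.2.1 - xs).le_opNorm _).trans <|
          mul_le_mul hk2.le hk1.le (norm_nonneg _) hζ0.le
      have b4 : ζ * (2 + M) ≤ δ ^ 2 := by
        rw [← le_div_iff₀ (by positivity)]
        exact min_le_right _ _
      rw [sub_apply] at b3
      linarith
    obtain ⟨q, hq, hq1, hq2⟩ := hN.exists_near hA.1 hA.mem_graph hk (by positivity) hgap
    rw [Real.sqrt_sq hδ.le] at hq1 hq2
    have hζη : ζ ≤ η / 2 := min_le_left _ _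
    refine ⟨q, hq, ?_, ?_, fun y hy => ?_⟩
    · have := norm_add_le (q.1 - k.1) k.1
      rw [sub_add_cancel] at this
      linarith
    · have := norm_add_le (q.2 - k.2.1) (k.2.1 - xs)
      rw [sub_add_sub_cancel] at this
      linarith
    · have c1 := hkF y (Finset.mem_insert_of_mem hy)
      have c2 : |y (q.1 - k.1)| ≤ ‖y‖ * η :=
        (y.le_opNorm _).trans (mul_le_mul_of_nonneg_left (by linarith) (norm_nonneg _))
      have c3 := abs_add_le (y (q.1 - k.1)) (y k.1 - xss y)
      rw [map_sub, sub_add_sub_cancel, ← map_sub] at c3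
      linarith
  choose g hg hg1 hg2 hg3 using fun i : Finset (StrongDual ℝ X) × ℕ =>
    key i.1 (1 / ((i.2 : ℝ) + 1)) (by positivity)
  have hle1 : ∀ n : ℕ, 1 / ((n : ℝ) + 1) ≤ 1 := fun n => by
    rw [div_le_one (by positivity)]
    linarith [(Nat.cast_nonneg n : (0 : ℝ) ≤ n)]
  have hsnd : Tendsto (fun i : Finset (StrongDual ℝ X) × ℕ => 1 / ((i.2 : ℝ) + 1)) atTop (𝓝 0) := by
    rw [← prod_atTop_atTop_eq]
    exact tendsto_one_div_add_atTop_nhds_zero_nat.comp tendsto_snd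
  refine ⟨Finset (StrongDual ℝ X) × ℕ, inferInstance, inferInstance, inferInstance,
    fun i => (g i).1, fun i => (g i).2, hg, ⟨M + 1 + ‖xs‖, fun i => ⟨?_, ?_⟩⟩, ?_, ?_⟩
  · linarith [hg1 i, hle1 i.2, norm_nonneg xs]
  · have := norm_add_le ((g i).2 - xs) xs
    rw [sub_add_cancel] at this
    linarith [hg2 i, hle1 i.2]
  · rw [tendsto_iff_forall_eval_tendsto_topDualPairing]
    intro y
    change Tendsto (fun i => y (g i).1) atTop (𝓝 (xss y))
    rw [tendsto_iff_norm_sub_tendsto_zero]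
    have hlim : Tendsto (fun i : Finset (StrongDual ℝ X) × ℕ =>
        (1 + ‖y‖) * (1 / ((i.2 : ℝ) + 1))) atTop (𝓝 0) := by
      simpa using hsnd.const_mul (1 + ‖y‖)
    refine squeeze_zero' (Eventually.of_forall fun i => norm_nonneg _) ?_ hlim
    filter_upwards [eventually_ge_atTop (({y}, 0) : Finset (StrongDual ℝ X) × ℕ)] with i hi
    exact hg3 i y (hi.1 (Finset.mem_singleton_self y))
  · rw [tendsto_iff_norm_sub_tendsto_zero]
    exact squeeze_zero (fun i => norm_nonneg _) hg2 hsnd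

theorem IsTypeFP.negInf {A : X → Set (StrongDual ℝ X)} (hA : IsMaximallyMonotone A)
    (hF : IsTypeFP A) : NegInf (graph A) := by
  intro xss xs ε hε
  by_contra! hcon
  obtain ⟨a₀, ha₀⟩ : (graph A).Nonempty := by
    by_contra! h
    have := hA.mem_graph 0 (by simp [h])
    simp [h] at this
  set d := a₀.2 - xs with hd
  obtain ⟨x, hx⟩ : ∃ x, d x = xss d := by
    by_cases h : d = 0
    · exact ⟨0, by simp [h]⟩
    obtain ⟨w, hw⟩ : ∃ w, d w ≠ 0 := by
      by_contra! h'
      exact h (ContinuousLinearMap.ext h')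
    exact ⟨(xss d / d w) • w, by simp [hw]⟩
  have hnot : (x, xs) ∉ graph A := by
    intro h
    have := hcon _ h
    simp at this
    linarith
  set ρ := ε / (‖x‖ + ‖xss‖ + 1) with hρdef
  have hρ : 0 < ρ := by positivity
  refine hnot (hF (Metric.thickening ρ (segment ℝ xs a₀.2)) Metric.isOpen_thickening
    ((convex_segment _ _).thickening ρ)
    ⟨a₀.2, Metric.self_subset_thickening hρ _ (right_mem_segment _ _ _),
      Set.mem_iUnion.2 ⟨a₀.1, ha₀⟩⟩ x xs
    (Metric.self_subset_thickening hρ _ (left_mem_segment _ _ _)) ?_)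
  rintro q ⟨hq, -, hqU⟩
  obtain ⟨y, hy, hqy⟩ := Metric.mem_thickening_iff.1 hqU
  rw [segment_eq_image'] at hy
  obtain ⟨s, -, rfl⟩ := hy
  set b := q.2 - (xs + s • d) with hb
  have hbn : ‖b‖ < ρ := by rwa [hb, ← dist_eq_norm]
  have hq2 : q.2 - xs = s • d + b := by rw [hb]; abel
  have h1 := hcon q hq
  have h2 : (q.2 - xs) x - xss (q.2 - xs) < ε := by
    rw [hq2]
    simp only [add_apply, smul_apply, map_add, map_smul, smul_eq_mul, hx]
    have b1 : b x ≤ ρ * ‖x‖ := (le_abs_self _).trans ((b.le_opNorm x).trans (by gcongr))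
    have b2 : -xss b ≤ ‖xss‖ * ρ := (neg_le_abs _).trans ((xss.le_opNorm b).trans (by gcongr))
    have e : ρ * (‖x‖ + ‖xss‖ + 1) = ε := div_mul_cancel₀ _ (by positivity)
    linarith
  simp only [map_sub, sub_apply] at h1 h2 ⊢
  linarith

theorem NegInf.isTypeFP [CompleteSpace X] {A : X → Set (StrongDual ℝ X)}
    (hA : IsMaximallyMonotone A) (hN : NegInf (graph A)) : IsTypeFP A := by
  rintro U hUo hUc ⟨as, hasU, has⟩ x xs hxs hrel
  obtain ⟨a, ha⟩ := Set.mem_iUnion.1 has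
  have h0 : (0, 0) ∈ BanachOperator.translate (graph A) (x, xs) := by
    refine (hN.translate (x, xs)).zero_mem_of_nonneg_on (MonotoneSet.translate hA.1 _)
      (U := (fun y => xs + y) ⁻¹' U) (z := (a, as) - (x, xs)) ?_
      (hUo.preimage (by fun_prop)) (hUc.translate_preimage_right xs) (by simpa using hxs)
      ⟨(a, as), ha, rfl⟩ (by simpa using hasU) ?_
    · intro p hp
      refine ⟨p + (x, xs), hA.mem_graph _ fun q hq => ?_, by simp⟩
      have := hp _ ⟨q, hq, rfl⟩
      have e1 : p.1 - (q - (x, xs)).1 = (p + (x, xs)).1 - q.1 := by simp; abel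
      have e2 : p.2 - (q - (x, xs)).2 = (p + (x, xs)).2 - q.2 := by simp; abel
      rwa [e1, e2] at this
    · rintro _ ⟨q, hq, rfl⟩ hqU
      have := hrel q ⟨hq, trivial, by simpa using hqU⟩
      simp only [Prod.fst_sub, Prod.snd_sub, map_sub, sub_apply] at this ⊢
      linarith
  obtain ⟨q, hq, hq0⟩ := h0
  have : q = (x, xs) := sub_eq_zero.1 hq0
  exact this ▸ hq

end BanachOperator

theorem corollary3 {X : Type u} [NormedAddCommGroup X] [NormedSpace ℝ X] [CompleteSpace X]
    (A : X → Set (StrongDual ℝ X)) (hA : BanachOperator.IsMaximallyMonotone A) :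
    List.TFAE [BanachOperator.IsTypeD A, BanachOperator.IsTypeNI A,
      BanachOperator.IsTypeFP A] := by
  rw [BanachOperator.isTypeNI_iff_negInf]
  tfae_have 1 → 2 := fun h => h.negInf
  tfae_have 2 → 1 := fun h => h.isTypeD hA
  tfae_have 2 → 3 := fun h => h.isTypeFP hA
  tfae_have 3 → 2 := fun h => h.negInf hA
  tfae_finish
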